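/- Let $K$ be a compact Hausdorff space and let $d\colon K\times K\to[0,+\infty)$ be a metric on $K$ that is lower semicontinuous as a function on $K\times K$ (with the product of the compact topology). If the topology generated by $d$ is strictly finer than the given compact topology of $K$, then the Banach space $C(K)$ of real-valued continuous functions on $K$ (for the compact topology), with the supremum norm, contains a Lipschitz subspace isometric to $c_0$; that is, there is a linear subspace $X\subset C(K)$ such that every $f\in X$ is Lipschitz with respect to $d$, and $X$ with the supremum norm is linearly isometric to the Banach space $c_0$ of real sequences converging to $0$ with the supremum norm. -/

import Mathlib

open scoped ZeroAtInfty NNReal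

namespace LipSub

/-- The topology on `K` generated by the metric `d`. -/
abbrev metricTopology {K : Type*} (d : MetricSpace K) : TopologicalSpace K :=
  d.toPseudoMetricSpace.toUniformSpace.toTopologicalSpace

/-- The metric `d`, as a real function on `K × K`, is lower semicontinuous for the product of the
topology `τ` with itself. -/
def IsLscMetric {K : Type*} (τ : TopologicalSpace K) (d : MetricSpace K) : Prop :=
  @LowerSemicontinuous (K × K) ℝ (@instTopologicalSpaceProd K K τ τ) _
    (fun p : K × K => d.dist p.1 p.2)

/-- `f` is Lipschitz with respect to the metric `d`. -/
def IsLip {K : Type*} (d : MetricSpace K) (f : K → ℝ) : Prop :=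
  ∃ L : ℝ≥0, LipschitzWith L f

/-- A linear subspace of `C(K)` (continuity refers to the topology of `K`) is a Lipschitz subspace
if all its elements are Lipschitz with respect to `d`. -/
def IsLipschitzSubspace {K : Type*} (d : MetricSpace K) [τ : TopologicalSpace K]
    (X : Submodule ℝ (@ContinuousMap K ℝ τ _)) : Prop :=
  ∀ f ∈ X, IsLip d f

end LipSub

/-!
By compactness and lower semicontinuity, the closed `d`-enlargements of a closed set are closed.
Hence Urysohn's interpolation can be carried out so that, in addition, level sets are separated in
`d` by at least the difference of their levels: closed sets at positive `d`-distance are separated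
by continuous functions which are `d`-Lipschitz. If some ball around `x` is not a neighbourhood of
`x`, there are points arbitrarily close to `x` in the compact topology and yet far from `x` for `d`.
Bump functions at such points, chosen inductively, are uniformly Lipschitz and disjointly supported.
Their `c₀`-combinations form the required subspace; they are Lipschitz because at two given points
at most two of the bump functions do not vanish.
-/

namespace LipSub

open Set Metric Function Topology

section Cuts

-- Instance resolution prefers `τ` to the topology of the pseudometric: in this section balls and
-- Lipschitz conditions refer to the pseudometric, every topological notion refers to `τ`.
variable {K : Type*} [PseudoMetricSpace K] [τ : TopologicalSpace K]

lemma isClosed_closedBall_of_lowerSemicontinuous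
    (hd : LowerSemicontinuous fun p : K × K => dist p.1 p.2) (x : K) (r : ℝ) :
    IsClosed (closedBall x r) := by
  have h : closedBall x r = Prod.mk x ⁻¹' {p : K × K | dist p.1 p.2 ≤ r} :=
    ext fun _ => mem_closedBall'
  rw [h]
  exact (hd.isClosed_preimage r).preimage (Continuous.prodMk_right x)

lemma isClosed_biUnion_closedBall [CompactSpace K]
    (hd : LowerSemicontinuous fun p : K × K => dist p.1 p.2) {C : Set K} (hC : IsClosed C) (r : ℝ) :
    IsClosed (⋃ c ∈ C, closedBall c r) := by
  have h : ⋃ c ∈ C, closedBall c r =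
      Prod.snd '' (Prod.fst ⁻¹' C ∩ {p : K × K | dist p.1 p.2 ≤ r}) := by
    ext y
    simp [dist_comm y]
  rw [h]
  exact isClosedMap_snd_of_compactSpace _ ((hC.preimage continuous_fst).inter
    (hd.isClosed_preimage r))

variable (K) in
/-- A cut, as in the proof of Urysohn's lemma: it prescribes that the function `f` to be constructed
be at least `level` off the open set `inner` and at most `level` on the closed set `outer`. -/
structure Cut where
  level : ℝ
  inner : Set K
  outer : Set K
  isOpen_inner : IsOpen inner
  isClosed_outer : IsClosed outer
  inner_subset_outer : inner ⊆ outer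

/-- Two cuts are compatible if their prescriptions are consistent with the function being Lipschitz
with constant one; only the case where `p` has the lower level is considered, which makes the
relation asymmetric. -/
def Cut.Compatible (p q : Cut K) : Prop :=
  p.level < q.level → ∀ x ∈ p.outer, closedBall x (q.level - p.level) ⊆ q.inner

lemma Cut.Compatible.level_le {p q : Cut K} (h : q.Compatible p) {x : K} (hp : x ∉ p.inner)
    (hq : x ∈ q.outer) : p.level ≤ q.level := by
  by_contra! hlt
  exact hp (h hlt x hq (mem_closedBall_self (sub_nonneg.2 hlt.le)))

lemma exists_cut_pairwise_compatible_insert [CompactSpace K] [NormalSpace K]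
    (hd : LowerSemicontinuous fun p : K × K => dist p.1 p.2) {S : Set (Cut K)}
    (hS : S.Pairwise Cut.Compatible) (hfin : S.Finite) (t : ℝ) :
    ∃ c : Cut K, c.level = t ∧ (insert c S).Pairwise Cut.Compatible := by
  -- The new cut has to contain `L` and to avoid `M`.
  let L : Set K := ⋃ p ∈ {p ∈ S | p.level < t}, ⋃ x ∈ p.outer, closedBall x (t - p.level)
  let M : Set K := ⋃ q ∈ {q ∈ S | t < q.level}, ⋃ y ∈ q.innerᶜ, closedBall y (q.level - t)
  have hL : IsClosed L := (hfin.subset (sep_subset _ _)).isClosed_biUnion fun p _ =>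
    isClosed_biUnion_closedBall hd p.isClosed_outer _
  have hM : IsClosed M := (hfin.subset (sep_subset _ _)).isClosed_biUnion fun q _ =>
    isClosed_biUnion_closedBall hd q.isOpen_inner.isClosed_compl _
  have hLM : L ⊆ Mᶜ := by
    intro z hzL hzM
    simp only [L, M, mem_iUnion, exists_prop] at hzL hzM
    obtain ⟨p, ⟨hp, hpt⟩, x, hx, hzx⟩ := hzL
    obtain ⟨q, ⟨hq, htq⟩, y, hy, hzy⟩ := hzM
    have hpq : p.level < q.level := hpt.trans htq
    refine hy (hS hp hq (fun h => hpq.ne (congrArg Cut.level h)) hpq x hx ?_)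
    rw [mem_closedBall] at hzx hzy ⊢
    linarith [dist_triangle_left y x z]
  obtain ⟨u, hu, hLu, huM⟩ := normal_exists_closure_subset hL hM.isOpen_compl hLM
  refine ⟨⟨t, u, closure u, hu, isClosed_closure, subset_closure⟩, rfl,
    hS.insert fun p hp _ => ⟨?_, ?_⟩⟩
  · intro htp x hx y hy
    by_contra hyp
    exact huM hx (mem_biUnion ⟨hp, htp⟩ (mem_biUnion hyp (mem_closedBall_comm.1 hy)))
  · intro hpt x hx
    exact fun y hy => hLu (mem_biUnion ⟨hp, hpt⟩ (mem_biUnion hx hy))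

lemma exists_pairwise_compatible_dense [CompactSpace K] [NormalSpace K]
    (hd : LowerSemicontinuous fun p : K × K => dist p.1 p.2) {S : Set (Cut K)}
    (hS : S.Pairwise Cut.Compatible) (hfin : S.Finite) :
    ∃ T, S ⊆ T ∧ T.Pairwise Cut.Compatible ∧ Dense (Cut.level '' T) := by
  let P := {T : Set (Cut K) // T.Pairwise Cut.Compatible ∧ T.Finite}
  let hasLevel (t : ℚ) : Order.Cofinal P :=
    { carrier := {T | (t : ℝ) ∈ Cut.level '' T.1}
      isCofinal := fun T => by
        obtain ⟨c, hct, hc⟩ := exists_cut_pairwise_compatible_insert hd T.2.1 T.2.2 t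
        exact ⟨⟨insert c T.1, hc, T.2.2.insert c⟩, ⟨c, mem_insert _ _, hct⟩, subset_insert _ _⟩ }
  let I := Order.idealOfCofinals ⟨S, hS, hfin⟩ hasLevel
  have hdir : DirectedOn (· ⊆ ·) (Subtype.val '' (I : Set P)) :=
    directedOn_image.2 I.directed
  refine ⟨⋃₀ (Subtype.val '' (I : Set P)),
    subset_sUnion_of_mem (mem_image_of_mem _ (Order.mem_idealOfCofinals _ hasLevel)),
    (pairwise_sUnion hdir).2 ?_, Rat.denseRange_cast.mono ?_⟩
  · rintro _ ⟨T, -, rfl⟩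
    exact T.2.1
  · rintro _ ⟨t, rfl⟩
    obtain ⟨T, ht, hT⟩ := Order.cofinal_meets_idealOfCofinals ⟨S, hS, hfin⟩ hasLevel t
    exact image_mono (subset_sUnion_of_mem (mem_image_of_mem _ hT)) ht

/-- A compatible family of cuts with enough levels to determine a real function. -/
structure IsCutScale (S : Set (Cut K)) : Prop where
  compatible : S.Pairwise Cut.Compatible
  dense : Dense (Cut.level '' S)
  exists_notMem_inner : ∀ x, ∃ p ∈ S, x ∉ p.inner
  exists_mem_outer : ∀ x, ∃ p ∈ S, x ∈ p.outer

/-- The function prescribed by a family of cuts. When the family is a cut scale, the infimum is over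
a nonempty set of levels that is bounded below. -/
noncomputable def cutFunction (S : Set (Cut K)) (x : K) : ℝ :=
  sInf (Cut.level '' {p ∈ S | x ∈ p.outer})

namespace IsCutScale

variable {S : Set (Cut K)} {p q : Cut K} {x : K}

lemma level_le_level (hS : IsCutScale S) (hp : p ∈ S) (hq : q ∈ S) (hxp : x ∉ p.inner)
    (hxq : x ∈ q.outer) : p.level ≤ q.level := by
  obtain rfl | hne := eq_or_ne q p
  · exact le_rfl
  · exact (hS.compatible hq hp hne).level_le hxp hxq

lemma cutFunction_le (hS : IsCutScale S) (hp : p ∈ S) (hx : x ∈ p.outer) :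
    cutFunction S x ≤ p.level := by
  obtain ⟨q, hq, hxq⟩ := hS.exists_notMem_inner x
  refine csInf_le ⟨q.level, ?_⟩ ⟨p, ⟨hp, hx⟩, rfl⟩
  rintro _ ⟨p', ⟨hp', hx'⟩, rfl⟩
  exact hS.level_le_level hq hp' hxq hx'

lemma le_cutFunction (hS : IsCutScale S) (hp : p ∈ S) (hx : x ∉ p.inner) :
    p.level ≤ cutFunction S x := by
  obtain ⟨q, hq, hxq⟩ := hS.exists_mem_outer x
  refine le_csInf ⟨q.level, q, ⟨hq, hxq⟩, rfl⟩ ?_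
  rintro _ ⟨q', ⟨hq', hx'⟩, rfl⟩
  exact hS.level_le_level hp hq' hx hx'

lemma exists_level_mem_Ioo (hS : IsCutScale S) {a b : ℝ} (hab : a < b) :
    ∃ p ∈ S, p.level ∈ Ioo a b := by
  obtain ⟨_, ⟨p, hp, rfl⟩, h⟩ := hS.dense.exists_between hab
  exact ⟨p, hp, h⟩

lemma continuous_cutFunction (hS : IsCutScale S) : Continuous (cutFunction S) := by
  refine continuous_iff_continuousAt.2 fun x => tendsto_order.2 ⟨fun a ha => ?_, fun b hb => ?_⟩
  · obtain ⟨p, hp, hap, hpx⟩ := hS.exists_level_mem_Ioo ha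
    have hx : x ∉ p.outer := fun hx => (hS.cutFunction_le hp hx).not_gt hpx
    filter_upwards [p.isClosed_outer.isOpen_compl.mem_nhds hx] with y hy
    exact hap.trans_le (hS.le_cutFunction hp fun hy' => hy (p.inner_subset_outer hy'))
  · obtain ⟨p, hp, hxp, hpb⟩ := hS.exists_level_mem_Ioo hb
    have hx : x ∈ p.inner := by
      by_contra hx
      exact (hS.le_cutFunction hp hx).not_gt hxp
    filter_upwards [p.isOpen_inner.mem_nhds hx] with y hy
    exact (hS.cutFunction_le hp (p.inner_subset_outer hy)).trans_lt hpb

lemma lipschitzWith_cutFunction (hS : IsCutScale S) : LipschitzWith 1 (cutFunction S) := by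
  refine LipschitzWith.of_le_add fun x y => ?_
  by_contra! hlt
  obtain ⟨q, hq, hyq, hqx⟩ := hS.exists_level_mem_Ioo hlt
  obtain ⟨p, hp, hyp, hpq⟩ := hS.exists_level_mem_Ioo (lt_sub_iff_add_lt.2 hyq)
  have hy : y ∈ p.outer := by
    by_contra hy
    exact (hS.le_cutFunction hp fun hy' => hy (p.inner_subset_outer hy')).not_gt hyp
  have hlevel : p.level < q.level := by linarith [dist_nonneg (x := x) (y := y)]
  have hx : x ∈ q.inner := by
    refine hS.compatible hp hq (fun h => hlevel.ne (congrArg Cut.level h)) hlevel y hy ?_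
    rw [mem_closedBall]
    linarith
  exact (hS.cutFunction_le hq (q.inner_subset_outer hx)).not_gt hqx

end IsCutScale

theorem exists_continuousMap_lipschitzWith_one [CompactSpace K] [NormalSpace K]
    (hd : LowerSemicontinuous fun p : K × K => dist p.1 p.2) {A B : Set K} (hA : IsClosed A)
    (hB : IsClosed B) {a b : ℝ} (hab : a ≤ b) (hAB : ∀ x ∈ A, ∀ y ∈ B, b - a < dist x y) :
    ∃ f : C(K, ℝ), LipschitzWith 1 f ∧ (∀ x, f x ∈ Icc a b) ∧ (∀ x ∈ A, f x = a) ∧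
      ∀ x ∈ B, f x = b := by
  let bot : Cut K := ⟨a, ∅, A, isOpen_empty, hA, empty_subset A⟩
  let top : Cut K := ⟨b, Bᶜ, univ, hB.isOpen_compl, isClosed_univ, subset_univ _⟩
  have hpair : ({bot, top} : Set (Cut K)).Pairwise Cut.Compatible := by
    refine pairwise_pair.2 fun _ => ⟨fun _ x hx y hy hyB => ?_, fun hlt => absurd hab hlt.not_ge⟩
    exact (hAB x hx y hyB).not_ge (mem_closedBall'.1 hy)
  obtain ⟨S, hsub, hcomp, hdense⟩ := exists_pairwise_compatible_dense hd hpair (toFinite _)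
  have hbot : bot ∈ S := hsub (mem_insert _ _)
  have htop : top ∈ S := hsub (mem_insert_of_mem _ rfl)
  have hS : IsCutScale S :=
    ⟨hcomp, hdense, fun x => ⟨bot, hbot, notMem_empty x⟩, fun x => ⟨top, htop, mem_univ x⟩⟩
  have hIcc : ∀ x, cutFunction S x ∈ Icc a b := fun x =>
    ⟨hS.le_cutFunction hbot (notMem_empty x), hS.cutFunction_le htop (mem_univ x)⟩
  exact ⟨⟨cutFunction S, hS.continuous_cutFunction⟩, hS.lipschitzWith_cutFunction, hIcc,
    fun x hx => (hS.cutFunction_le hbot hx).antisymm (hIcc x).1,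
    fun x hx => (hIcc x).2.antisymm (hS.le_cutFunction htop (not_not_intro hx))⟩

lemma exists_lipschitz_bump [CompactSpace K] [T2Space K]
    (hd : LowerSemicontinuous fun p : K × K => dist p.1 p.2) {A : Set K} (hA : IsClosed A)
    {b : K} {δ : ℝ≥0} (hδ : 0 < δ) (hAb : ∀ x ∈ A, 2 * δ < dist x b) :
    ∃ f : C(K, ℝ), LipschitzWith δ⁻¹ f ∧ ‖f‖ = 1 ∧ Disjoint A (tsupport f) := by
  have hδ' : (0 : ℝ) < δ := hδ
  obtain ⟨f, hlip, hIcc, hfA, hfb⟩ := exists_continuousMap_lipschitzWith_one hd hA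
    (isClosed_singleton (x := b)) (neg_le_self hδ'.le) (by simpa [← two_mul] using hAb)
  -- Only the positive part of `f` is kept, so that the support stays away from `A`, where `f < 0`.
  let g : C(K, ℝ) := ⟨fun x => (δ : ℝ)⁻¹ * max (f x) 0, by fun_prop⟩
  have hg_nonneg (x : K) : 0 ≤ g x := mul_nonneg (inv_nonneg.2 hδ'.le) (le_max_right _ _)
  have hg_le (x : K) : g x ≤ 1 := by
    calc (δ : ℝ)⁻¹ * max (f x) 0 ≤ (δ : ℝ)⁻¹ * δ := by
          gcongr
          exact max_le (hIcc x).2 hδ'.le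
      _ = 1 := inv_mul_cancel₀ hδ'.ne'
  have hgb : g b = 1 := by
    change (δ : ℝ)⁻¹ * max (f b) 0 = 1
    rw [hfb b rfl, max_eq_left hδ'.le, inv_mul_cancel₀ hδ'.ne']
  have hsupp : tsupport g ⊆ {x | 0 ≤ f x} := by
    refine closure_minimal (fun x hx => ?_) (isClosed_le continuous_const f.continuous)
    refine le_of_not_gt (α := ℝ) fun hfx => hx ?_
    change (δ : ℝ)⁻¹ * max (f x) 0 = 0
    rw [max_eq_right hfx.le, mul_zero]
  refine ⟨g, ?_, le_antisymm ?_ ?_, disjoint_left.2 fun x hxA hx => ?_⟩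
  · simpa [g, comp_def] using (lipschitzWith_smul (δ : ℝ)⁻¹).comp (hlip.max_const 0)
  · refine (g.norm_le zero_le_one).2 fun x => ?_
    rw [Real.norm_of_nonneg (hg_nonneg x)]
    exact hg_le x
  · simpa [hgb] using g.norm_coe_le_norm b
  · have : 0 ≤ f x := hsupp hx
    rw [hfA x hxA] at this
    linarith

lemma exists_lipschitz_bump_disjoint [CompactSpace K] [T2Space K]
    (hd : LowerSemicontinuous fun p : K × K => dist p.1 p.2) {x : K} {δ : ℝ≥0} (hδ : 0 < δ)
    (hx : closedBall x (4 * δ) ∉ 𝓝 x) {s : Finset C(K, ℝ)}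
    (hs : ∀ f ∈ s, ∀ᶠ u in 𝓝 x, Disjoint (closedBall u (2 * δ)) (tsupport f)) :
    ∃ g : C(K, ℝ), (LipschitzWith δ⁻¹ g ∧ ‖g‖ = 1 ∧
      ∀ᶠ u in 𝓝 x, Disjoint (closedBall u (2 * δ)) (tsupport g)) ∧
      ∀ f ∈ s, Disjoint (tsupport f) (tsupport g) := by
  obtain ⟨b, hbx, hbs⟩ : ∃ b ∉ closedBall x (4 * δ), ∀ f ∈ s,
      Disjoint (closedBall b (2 * δ)) (tsupport f) := by
    by_contra! hcon
    refine hx ?_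
    filter_upwards [(Filter.eventually_all_finset s).2 hs] with u hu
    by_contra hux
    obtain ⟨f, hf, hfu⟩ := hcon u hux
    exact hfu (hu f hf)
  have hfar : (closedBall b (4 * δ))ᶜ ∈ 𝓝 x :=
    (isClosed_closedBall_of_lowerSemicontinuous hd b _).isOpen_compl.mem_nhds
      (mem_closedBall_comm.not.1 hbx)
  obtain ⟨U, hU, hUc, hUb⟩ := exists_mem_nhds_isClosed_subset hfar
  let A : Set K := (⋃ u ∈ U, closedBall u (2 * δ)) ∪ ⋃ f ∈ s, tsupport f
  have hA : IsClosed A := (isClosed_biUnion_closedBall hd hUc _).union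
    (s.finite_toSet.isClosed_biUnion fun f _ => isClosed_tsupport f)
  have hAb : ∀ a ∈ A, 2 * (δ : ℝ) < dist a b := by
    rintro a (ha | ha) <;> simp only [mem_iUnion, exists_prop] at ha
    · obtain ⟨u, hu, hau⟩ := ha
      have hub : 4 * (δ : ℝ) < dist u b := not_le.1 (hUb hu)
      linarith [dist_triangle_left u b a, mem_closedBall.1 hau]
    · obtain ⟨f, hf, haf⟩ := ha
      exact not_le.1 fun hab => disjoint_left.1 (hbs f hf) hab haf
  obtain ⟨g, hlip, hnorm, hdisj⟩ := exists_lipschitz_bump hd hA hδ hAb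
  refine ⟨g, ⟨hlip, hnorm, ?_⟩, fun f hf => hdisj.mono_left fun y hy => ?_⟩
  · filter_upwards [hU] with u hu
    exact hdisj.mono_left fun y hy => .inl (mem_biUnion hu hy)
  · exact .inr (mem_biUnion (s := (s : Set C(K, ℝ))) hf hy)

theorem exists_seq_lipschitz_bumps [CompactSpace K] [T2Space K]
    (hd : LowerSemicontinuous fun p : K × K => dist p.1 p.2) {x : K} {δ : ℝ≥0} (hδ : 0 < δ)
    (hx : closedBall x (4 * δ) ∉ 𝓝 x) :
    ∃ g : ℕ → C(K, ℝ), (∀ n, LipschitzWith δ⁻¹ (g n)) ∧ (∀ n, ‖g n‖ = 1) ∧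
      Pairwise (Disjoint on fun n => support (g n)) := by
  have : Std.Symm fun f g : C(K, ℝ) => Disjoint (tsupport f) (tsupport g) := ⟨fun _ _ h => h.symm⟩
  obtain ⟨g, hg, hdisj⟩ := exists_seq_of_forall_finset_exists'
    (fun f : C(K, ℝ) => LipschitzWith δ⁻¹ f ∧ ‖f‖ = 1 ∧
      ∀ᶠ u in 𝓝 x, Disjoint (closedBall u (2 * δ)) (tsupport f))
    (fun f g => Disjoint (tsupport f) (tsupport g))
    fun s hs => exists_lipschitz_bump_disjoint hd hδ hx fun f hf => (hs f hf).2.2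
  exact ⟨g, fun n => (hg n).1, fun n => (hg n).2.1, fun m n hmn =>
    (hdisj hmn).mono (subset_tsupport _) (subset_tsupport _)⟩

end Cuts

section DisjointSupports

variable {ι 𝕜 E : Type*} [NormedField 𝕜] [NormedAddCommGroup E] [NormedSpace 𝕜 E]

lemma apply_eq_zero_of_mem_support {X : Type*} {g : ι → X → E}
    (hg : Pairwise (Disjoint on fun i => support (g i))) {x : X} {i j : ι} (hi : x ∈ support (g i))
    (hij : j ≠ i) : g j x = 0 :=
  notMem_support.1 (disjoint_left.1 (hg hij.symm) hi)

lemma exists_finset_card_le_one_forall_notMem {X : Type*} {g : ι → X → E}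
    (hg : Pairwise (Disjoint on fun i => support (g i))) (x : X) :
    ∃ s : Finset ι, s.card ≤ 1 ∧ ∀ i ∉ s, g i x = 0 := by
  by_cases h : ∃ i, x ∈ support (g i)
  · obtain ⟨i, hi⟩ := h
    exact ⟨{i}, (Finset.card_singleton i).le, fun j hj =>
      apply_eq_zero_of_mem_support hg hi (Finset.notMem_singleton.1 hj)⟩
  · exact ⟨∅, zero_le_one, fun i _ => notMem_support.1 fun hi => h ⟨i, hi⟩⟩

lemma lipschitzWith_tsum_smul_of_disjoint_support {X : Type*} [PseudoMetricSpace X]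
    {g : ι → X → E} {L M : ℝ≥0} (hlip : ∀ i, LipschitzWith L (g i))
    (hg : Pairwise (Disjoint on fun i => support (g i)))
    {a : ι → 𝕜} (ha : ∀ i, ‖a i‖ ≤ M) :
    LipschitzWith (2 * (M * L)) fun x => ∑' i, a i • g i x := by
  classical
  refine LipschitzWith.of_dist_le_mul fun x y => ?_
  obtain ⟨s, hs, hsx⟩ := exists_finset_card_le_one_forall_notMem hg x
  obtain ⟨t, ht, hty⟩ := exists_finset_card_le_one_forall_notMem hg y
  have hterm : ∀ i ∈ s ∪ t, ‖a i • g i x - a i • g i y‖ ≤ M * (L * dist x y) := fun i _ => by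
    rw [← smul_sub, norm_smul, ← dist_eq_norm]
    exact mul_le_mul (ha i) ((hlip i).dist_le_mul x y) dist_nonneg M.2
  have hcard : ((s ∪ t).card : ℝ) ≤ 2 := by
    exact_mod_cast (Finset.card_union_le s t).trans (add_le_add hs ht)
  have hx : ∀ i ∉ s ∪ t, a i • g i x = 0 := fun i hi => by
    rw [hsx i fun his => hi (Finset.mem_union_left t his), smul_zero]
  have hy : ∀ i ∉ s ∪ t, a i • g i y = 0 := fun i hi => by
    rw [hty i fun hit => hi (Finset.mem_union_right s hit), smul_zero]
  calc dist (∑' i, a i • g i x) (∑' i, a i • g i y)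
      = ‖∑ i ∈ s ∪ t, (a i • g i x - a i • g i y)‖ := by
        rw [tsum_eq_sum hx, tsum_eq_sum hy, dist_eq_norm, Finset.sum_sub_distrib]
    _ ≤ (s ∪ t).card * (M * (L * dist x y)) := by
        simpa only [Finset.sum_const, nsmul_eq_mul] using norm_sum_le_of_le _ hterm
    _ ≤ 2 * (M * (L * dist x y)) := by gcongr
    _ = ↑(2 * (M * L)) * dist x y := by push_cast; ring

lemma norm_apply_le_norm {X : Type*} [TopologicalSpace X] (f : C₀(X, E)) (x : X) : ‖f x‖ ≤ ‖f‖ :=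
  f.toBCF.norm_coe_le_norm x

variable {K : Type*} [TopologicalSpace K] [CompactSpace K] {g : ι → C(K, E)}

lemma norm_sum_smul_le_of_disjoint_support (hg : Pairwise (Disjoint on fun i => support (g i)))
    (hnorm : ∀ i, ‖g i‖ ≤ 1) {a : ι → 𝕜} {t : Finset ι} {M : ℝ} (hM : 0 ≤ M)
    (ha : ∀ i ∈ t, ‖a i‖ ≤ M) : ‖∑ i ∈ t, a i • g i‖ ≤ M := by
  refine (ContinuousMap.norm_le _ hM).2 fun x => ?_
  simp only [ContinuousMap.sum_apply, ContinuousMap.smul_apply]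
  by_cases h : ∃ i ∈ t, x ∈ support (g i)
  · obtain ⟨i, hit, hi⟩ := h
    rw [Finset.sum_eq_single_of_mem i hit fun j _ hji => by
      rw [apply_eq_zero_of_mem_support hg hi hji, smul_zero], norm_smul]
    exact (mul_le_of_le_one_right (norm_nonneg _)
      (((g i).norm_coe_le_norm x).trans (hnorm i))).trans (ha i hit)
  · rw [Finset.sum_eq_zero fun i hi => by
      rw [notMem_support.1 fun hx => h ⟨i, hi, hx⟩, smul_zero], norm_zero]
    exact hM

variable [TopologicalSpace ι] [DiscreteTopology ι] [CompleteSpace E]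

lemma summable_smul_of_disjoint_support (hg : Pairwise (Disjoint on fun i => support (g i)))
    (hnorm : ∀ i, ‖g i‖ ≤ 1) (a : C₀(ι, 𝕜)) : Summable fun i => a i • g i := by
  refine summable_iff_vanishing_norm.2 fun ε hε => ?_
  have ha : Filter.Tendsto a Filter.cofinite (𝓝 0) := by
    rw [← Filter.cocompact_eq_cofinite]
    exact a.zero_at_infty'
  have hfin : {i | ¬ ‖a i‖ < ε / 2}.Finite :=
    Filter.eventually_cofinite.1 (by simpa using ha.norm.eventually_lt_const (by simpa using hε))
  refine ⟨hfin.toFinset, fun t ht => ?_⟩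
  refine (norm_sum_smul_le_of_disjoint_support hg hnorm (half_pos hε).le fun i hi => ?_).trans_lt
    (half_lt_self hε)
  by_contra! hlt
  exact Finset.disjoint_left.1 ht hi (hfin.mem_toFinset.2 hlt.le.not_gt)

lemma norm_tsum_smul_of_disjoint_support (hg : Pairwise (Disjoint on fun i => support (g i)))
    (hnorm : ∀ i, ‖g i‖ = 1) (a : C₀(ι, 𝕜)) : ‖∑' i, a i • g i‖ = ‖a‖ := by
  have hsum := summable_smul_of_disjoint_support hg (fun i => (hnorm i).le) a
  refine le_antisymm ?_ ?_
  · exact le_of_tendsto hsum.hasSum.norm (.of_forall fun t =>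
      norm_sum_smul_le_of_disjoint_support hg (fun i => (hnorm i).le) (norm_nonneg a)
        fun i _ => norm_apply_le_norm a i)
  · refine (BoundedContinuousFunction.norm_le (f := a.toBCF) (norm_nonneg _)).2 fun i => ?_
    suffices ‖a i • g i‖ ≤ ‖∑' j, a j • g j‖ by
      rwa [norm_smul, hnorm, mul_one] at this
    refine (ContinuousMap.norm_le _ (norm_nonneg _)).2 fun x => ?_
    by_cases hx : x ∈ support (g i)
    · have happly : (∑' j, a j • g j) x = a i • g i x := by
        rw [← ContinuousMap.tsum_apply hsum]
        exact tsum_eq_single i fun j hji => by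
          rw [ContinuousMap.smul_apply, apply_eq_zero_of_mem_support hg hx hji, smul_zero]
      rw [ContinuousMap.smul_apply, ← happly]
      exact ContinuousMap.norm_coe_le_norm _ x
    · rw [ContinuousMap.smul_apply, notMem_support.1 hx, smul_zero, norm_zero]
      exact norm_nonneg _

/-- The linear isometry from `c₀(ι)` into `C(K, E)` sending the unit vectors to given normalized
functions with disjoint supports. -/
noncomputable def c₀Embedding (hg : Pairwise (Disjoint on fun i => support (g i)))
    (hnorm : ∀ i, ‖g i‖ = 1) : C₀(ι, 𝕜) →ₗᵢ[𝕜] C(K, E) where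
  toFun a := ∑' i, a i • g i
  map_add' a b := by
    have hsum := summable_smul_of_disjoint_support (𝕜 := 𝕜) hg fun i => (hnorm i).le
    simp only [ZeroAtInftyContinuousMap.add_apply, add_smul, (hsum a).tsum_add (hsum b)]
  map_smul' c a := by
    have hsum := summable_smul_of_disjoint_support hg (fun i => (hnorm i).le) a
    simp only [ZeroAtInftyContinuousMap.smul_apply, smul_assoc, hsum.tsum_const_smul,
      RingHom.id_apply]
  norm_map' := norm_tsum_smul_of_disjoint_support hg hnorm

end DisjointSupports

lemma exists_closedBall_notMem_nhds {K : Type*} [d : PseudoMetricSpace K] [τ : TopologicalSpace K]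
    (h : ¬ τ ≤ d.toUniformSpace.toTopologicalSpace) :
    ∃ (x : K) (r : ℝ≥0), 0 < r ∧ closedBall x r ∉ 𝓝 x := by
  contrapose! h
  refine le_of_nhds_le_nhds fun x => nhds_basis_closedBall.ge_iff.2 fun r hr => ?_
  exact h x ⟨r, hr.le⟩ hr

end LipSub

theorem theorem4p2_general {K : Type*} [d : PseudoMetricSpace K] [τ : TopologicalSpace K]
    [CompactSpace K] [T2Space K] (hd : LowerSemicontinuous fun p : K × K => dist p.1 p.2)
    (h : ¬ τ ≤ d.toUniformSpace.toTopologicalSpace) :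
    ∃ X : Submodule ℝ C(K, ℝ),
      (∀ f ∈ X, ∃ L : ℝ≥0, LipschitzWith L f) ∧ Nonempty (X ≃ₗᵢ[ℝ] C₀(ℕ, ℝ)) := by
  obtain ⟨x, r, hr, hx⟩ := LipSub.exists_closedBall_notMem_nhds h
  obtain ⟨g, hlip, hnorm, hdisj⟩ := LipSub.exists_seq_lipschitz_bumps (δ := r / 4) hd
    (by positivity) (by rwa [NNReal.coe_div, NNReal.coe_ofNat, mul_div_cancel₀ _ four_ne_zero])
  let T : C₀(ℕ, ℝ) →ₗᵢ[ℝ] C(K, ℝ) := LipSub.c₀Embedding hdisj hnorm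
  refine ⟨LinearMap.range T.toLinearMap, ?_, ⟨T.equivRange.symm⟩⟩
  rintro _ ⟨a, rfl⟩
  have hsum := LipSub.summable_smul_of_disjoint_support hdisj (fun n => (hnorm n).le) a
  have happly : ⇑(T a) = fun y => ∑' n, a n • g n y :=
    funext fun y => (ContinuousMap.tsum_apply hsum y).symm
  refine ⟨2 * (‖a‖₊ * (r / 4)⁻¹), ?_⟩
  exact happly ▸ LipSub.lipschitzWith_tsum_smul_of_disjoint_support hlip hdisj
    (LipSub.norm_apply_le_norm a)

theorem theorem4p2 {K : Type*} (d : MetricSpace K) [τ : TopologicalSpace K]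
    [@CompactSpace K τ] [@T2Space K τ]
    (hlsc : LipSub.IsLscMetric τ d)
    (hfiner : LipSub.metricTopology d < τ) :
    ∃ X : Submodule ℝ C(K, ℝ),
      LipSub.IsLipschitzSubspace d X ∧ Nonempty (X ≃ₗᵢ[ℝ] C₀(ℕ, ℝ)) := by
  exact theorem4p2_general hlsc hfiner.not_ge
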